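/- Let $\mathcal{G}$ be a Grothendieck category. For a class $\mathcal{X}$ of objects of $\mathcal{G}$ put $\mathcal{X}^{\perp_1} = \{M : \operatorname{Ext}^1_{\mathcal{G}}(X,M)=0 \text{ for all } X\in\mathcal{X}\}$ and ${}^{\perp_1}\mathcal{X} = \{M : \operatorname{Ext}^1_{\mathcal{G}}(M,X)=0 \text{ for all } X\in\mathcal{X}\}$. For $n\ge 1$, an object $F$ is of type $\mathrm{FP}_n$ if $\operatorname{Ext}^i_{\mathcal{G}}(F,-)$ preserves direct limits for all $0\le i\le n-1$; let $\mathrm{FP}_n(\mathcal{G})$ be the class of these objects, and let $\mathcal{I}_n(\mathcal{G}) = \mathrm{FP}_n(\mathcal{G})^{\perp_1}$. A class $\mathcal{T}$ is a torsion class if there is a class $\mathcal{F}$ such that $\mathcal{F}$ consists exactly of the objects $Y$ with $\operatorname{Hom}(X,Y)=0$ for all $X\in\mathcal{T}$, and $\mathcal{T}$ consists exactly of the objects $X$ with $\operatorname{Hom}(X,Y)=0$ for all $Y\in\mathcal{F}$. For an object $T$, let $\operatorname{Gen}(T)$ be the class of quotients of coproducts $\bigoplus_{i\in I}T$ with $I$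 a set; $T$ is 1-tilting if $\operatorname{Gen}(T)=\{T\}^{\perp_1}$, and a 1-tilting class is a class of the form $\operatorname{Gen}(T)$ with $T$ a 1-tilting object. Theorem. Let $n\ge 1$. (a) Let $\mathcal{C}\subseteq \mathrm{FP}_n(\mathcal{G})$ be a class of objects such that ${}^{\perp_1}(\mathcal{C}^{\perp_1})$ contains a generator of $\mathcal{G}$. Then the following are equivalent: (i) $\mathcal{C}^{\perp_1}$ is a 1-tilting class; (ii) $\mathcal{C}^{\perp_1}$ is a torsion class; (iii) $\mathcal{C}^{\perp_1}$ is closed under quotients. (b) In particular, if ${}^{\perp_1}\mathcal{I}_n(\mathcal{G})$ contains a generating set of $\mathcal{G}$, then $\mathcal{I}_n(\mathcal{G})$ is a torsion class if and only if it is a 1-tilting class. -/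

import Mathlib

open CategoryTheory CategoryTheory.Limits CategoryTheory.Abelian

universe v u

noncomputable section

namespace GrothendieckTilting

variable {G : Type u} [Category.{v} G] [Abelian G] [IsGrothendieckAbelian.{v} G]

/-- `C^{⊥₁}`: the objects `M` with `Ext¹(X, M) = 0` for all `X` in `C`. -/
def rightExtPerp (C : ObjectProperty G) : ObjectProperty G :=
  fun M => ∀ X : G, C X → Subsingleton (Ext.{v} X M 1)

/-- `^{⊥₁}C`: the objects `M` with `Ext¹(M, X) = 0` for all `X` in `C`. -/
def leftExtPerp (C : ObjectProperty G) : ObjectProperty G :=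
  fun M => ∀ X : G, C X → Subsingleton (Ext.{v} M X 1)

/-- The functor `F` preserves direct limits, that is, colimits of (small) directed systems. -/
def PreservesDirectLimits (F : G ⥤ AddCommGrpCat.{v}) : Prop :=
  ∀ (J : Type v) [PartialOrder J] [IsDirectedOrder J] [Nonempty J],
    PreservesColimitsOfShape J F

/-- Objects `F` of type `FP_n`: the functors `Ext^i(F, -)`, `0 ≤ i ≤ n - 1`, preserve direct
limits. This is the intended notion only for `1 ≤ n`. -/
def IsTypeFP (G : Type u) [Category.{v} G] [Abelian G] [IsGrothendieckAbelian.{v} G]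
    (n : ℕ) : ObjectProperty G :=
  fun F => ∀ i : ℕ, i < n → PreservesDirectLimits (extFunctorObj.{v} F i)

/-- The class `I_n` of `FP_n`-injective objects. -/
def FPInjective (G : Type u) [Category.{v} G] [Abelian G] [IsGrothendieckAbelian.{v} G]
    (n : ℕ) : ObjectProperty G :=
  rightExtPerp (IsTypeFP G n)

/-- `(T, F)` is a torsion pair: `F = T^{⊥₀}` and `T = ^{⊥₀}F`, the orthogonals being taken
with respect to `Hom`. -/
def IsTorsionPair (T F : ObjectProperty G) : Prop :=
  F = T.rightOrthogonal ∧ T = F.leftOrthogonal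

/-- A torsion class is the first component of some torsion pair. -/
def IsTorsionClass (T : ObjectProperty G) : Prop :=
  ∃ F : ObjectProperty G, IsTorsionPair T F

/-- `Gen(T)`: the objects that are quotients of a coproduct of copies of `T` indexed by a set. -/
def Gen (T : G) : ObjectProperty G :=
  fun M => ∃ (I : Type v) (f : (∐ fun _ : I => T) ⟶ M), Epi f

/-- `T` is 1-tilting: `Gen(T) = T^{⊥₁}`. -/
def IsOneTilting (T : G) : Prop :=
  Gen T = rightExtPerp (ObjectProperty.singleton T)

/-- A 1-tilting class is a class of the form `Gen(T)` with `T` a 1-tilting object. -/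
def IsOneTiltingClass (C : ObjectProperty G) : Prop :=
  ∃ T : G, IsOneTilting T ∧ C = Gen T

/-- `C` contains a generating set: a set-indexed family of members of `C` that is separating. -/
def ContainsGeneratingSet (C : ObjectProperty G) : Prop :=
  ∃ (ι : Type v) (S : ι → G), (∀ i, C (S i)) ∧ (ObjectProperty.ofObj S).IsSeparating

end GrothendieckTilting

end

/-! Torsion classes are closed under quotients, and `Gen T` is a torsion class for 1-tilting `T` by
the usual trace argument. The substance is (iii) ⇒ (i). Take a separator `S` in the left perp of
`C^⊥` and a special preenvelope `0 → S → B → Q → 0` with `B` in `C^⊥` and `Q` in its left perp; then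
`T = B ⊞ Q` is tilting (`isOneTiltingClass_rightExtPerp`).

Everything rests on `Hom(F, -)` preserving direct limits for `F` in `C`. A class in `Ext¹(F, M)` is
represented by a map `F ⟶ E/M` with `E` injective. If `M` is a directed union of subobjects `M_j`,
then `E/M` is the direct limit of the `E/M_j`, so the class comes from some `M_j`
(`exists_ext_comp_coconeLeg_eq`). Hence `C^⊥` is closed under coproducts, and `B` is obtained after
only countably many universal extensions (`exists_special_preenvelope`). A set of objects of `C`
suffices, by `exists_small_representatives`. -/

noncomputable section

namespace GrothendieckTilting

variable {G : Type u} [Category.{v} G] [Abelian G]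

/-! ### Cokernels of maps into a fixed object, along filtered colimits -/

section CokernelDiagram

variable {J : Type v} [Category.{v} J] {D : J ⥤ G} (c : Cocone D) {Y : G} (g : c.pt ⟶ Y)

/-- The leg at `j` of a cocone. -/
abbrev coconeLeg (j : J) : D.obj j ⟶ c.pt := c.ι.app j

/-- The projection from the cokernel of `D.obj j ⟶ c.pt ⟶ Y` to the cokernel of `c.pt ⟶ Y`. -/
def cokernelLeg (j : J) : cokernel (coconeLeg c j ≫ g) ⟶ cokernel g :=
  cokernel.desc _ (cokernel.π g) (by rw [Category.assoc, cokernel.condition, comp_zero])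

lemma π_cokernelLeg (j : J) :
    cokernel.π (coconeLeg c j ≫ g) ≫ cokernelLeg c g j = cokernel.π g :=
  cokernel.π_desc _ _ _

/-- The transition morphisms between the cokernels of the morphisms `D.obj j ⟶ c.pt ⟶ Y`. -/
def cokernelTransition {i j : J} (φ : i ⟶ j) :
    cokernel (coconeLeg c i ≫ g) ⟶ cokernel (coconeLeg c j ≫ g) :=
  cokernel.desc _ (cokernel.π (coconeLeg c j ≫ g)) (by
    have h : coconeLeg c i = D.map φ ≫ coconeLeg c j := (c.w φ).symm
    rw [h, Category.assoc, Category.assoc, ← Category.assoc (coconeLeg c j), cokernel.condition,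
      comp_zero])

lemma π_cokernelTransition {i j : J} (φ : i ⟶ j) :
    cokernel.π (coconeLeg c i ≫ g) ≫ cokernelTransition c g φ =
      cokernel.π (coconeLeg c j ≫ g) :=
  cokernel.π_desc _ _ _

/-- The diagram of the cokernels of the morphisms `D.obj j ⟶ c.pt ⟶ Y`. -/
@[simps]
def cokernelDiagram : J ⥤ G where
  obj j := cokernel (coconeLeg c j ≫ g)
  map φ := cokernelTransition c g φ
  map_id j := by
    rw [← cancel_epi (cokernel.π (coconeLeg c j ≫ g)), π_cokernelTransition, Category.comp_id]
  map_comp φ ψ := by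
    rw [← cancel_epi (cokernel.π (coconeLeg c _ ≫ g)), π_cokernelTransition, ← Category.assoc,
      π_cokernelTransition, π_cokernelTransition]

/-- The cocone over `cokernelDiagram c g` with point `cokernel g`. -/
def cokernelCocone : Cocone (cokernelDiagram c g) where
  pt := cokernel g
  ι := { app := fun j => cokernelLeg c g j
         naturality := fun i j φ => (cancel_epi (cokernel.π (coconeLeg c i ≫ g))).1 (by
          change cokernel.π (coconeLeg c i ≫ g) ≫ cokernelTransition c g φ ≫ cokernelLeg c g j =
            cokernel.π (coconeLeg c i ≫ g) ≫ cokernelLeg c g i ≫ 𝟙 (cokernel g)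
          rw [← Category.assoc, π_cokernelTransition, Category.comp_id, π_cokernelLeg,
            π_cokernelLeg]) }

/-- Two indices map to a common one, so a cocone induces a single map out of `Y`, whichever index is
used. -/
lemma π_comp_ι_eq_of_cocone [IsFiltered J] (s : Cocone (cokernelDiagram c g)) (i j : J) :
    cokernel.π (coconeLeg c i ≫ g) ≫ (show cokernel (coconeLeg c i ≫ g) ⟶ s.pt from s.ι.app i) =
      cokernel.π (coconeLeg c j ≫ g) ≫
        (show cokernel (coconeLeg c j ≫ g) ⟶ s.pt from s.ι.app j) := by
  have key {i k : J} (φ : i ⟶ k) :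
      cokernel.π (coconeLeg c i ≫ g) ≫ (show cokernel (coconeLeg c i ≫ g) ⟶ s.pt from s.ι.app i) =
      cokernel.π (coconeLeg c k ≫ g) ≫
        (show cokernel (coconeLeg c k ≫ g) ⟶ s.pt from s.ι.app k) := by
    have h : cokernelTransition c g φ ≫
        (show cokernel (coconeLeg c k ≫ g) ⟶ s.pt from s.ι.app k) = s.ι.app i := s.w φ
    rw [← π_cokernelTransition c g φ, Category.assoc]
    exact congrArg (fun t => cokernel.π (coconeLeg c i ≫ g) ≫ t) h.symm
  exact (key (IsFiltered.leftToMax i j)).trans (key (IsFiltered.rightToMax i j)).symm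

variable {c} in
/-- Taking cokernels of morphisms to a fixed object commutes with filtered colimits. -/
def isColimitCokernelCocone [IsFiltered J] (hc : IsColimit c) :
    IsColimit (cokernelCocone c g) :=
  let j₀ : J := Classical.choice IsFiltered.nonempty
  { desc := fun s => cokernel.desc g (cokernel.π (coconeLeg c j₀ ≫ g) ≫
        (show cokernel (coconeLeg c j₀ ≫ g) ⟶ s.pt from s.ι.app j₀))
      (hc.hom_ext fun j => by
        rw [π_comp_ι_eq_of_cocone c g s j₀ j, comp_zero]
        change coconeLeg c j ≫ g ≫ _ ≫ _ = 0
        rw [← Category.assoc, ← Category.assoc, cokernel.condition, zero_comp])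
    fac := fun s j => (cancel_epi (cokernel.π (coconeLeg c j ≫ g))).1 (by
      refine Eq.trans ?_ (π_comp_ι_eq_of_cocone c g s j₀ j)
      change cokernel.π (coconeLeg c j ≫ g) ≫ cokernelLeg c g j ≫ _ = _
      rw [← Category.assoc, π_cokernelLeg, cokernel.π_desc])
    uniq := fun s m hm => (cancel_epi (cokernel.π g)).1 (by
      rw [cokernel.π_desc]
      refine Eq.trans ?_ (congrArg (fun t => cokernel.π (coconeLeg c j₀ ≫ g) ≫ t) (hm j₀))
      exact (congrArg (fun t => t ≫ (show cokernel g ⟶ s.pt from m))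
        (π_cokernelLeg c g j₀)).symm.trans (Category.assoc _ _ _)) }

end CokernelDiagram

/-- The short complex `X ⟶ Y ⟶ cokernel i` of a morphism `i`. -/
abbrev cokernelComplex {X Y : G} (i : X ⟶ Y) : ShortComplex G :=
  ShortComplex.mk i (cokernel.π i) (cokernel.condition i)

lemma shortExact_cokernelComplex {X Y : G} (i : X ⟶ Y) [Mono i] :
    (cokernelComplex i).ShortExact where
  exact := ShortComplex.exact_cokernel i
  mono_f := inferInstance
  epi_g := inferInstance

variable [IsGrothendieckAbelian.{v} G]

/-! ### Maps from `F` into direct limits -/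

section HomColimits

variable {F : G} (hF : PreservesDirectLimits (extFunctorObj.{v} F 0))
  {J : Type v} [PartialOrder J] [IsDirectedOrder J] [Nonempty J]

include hF

lemma exists_factor_of_isColimit {D : J ⥤ G} {c : Cocone D} (hc : IsColimit c) (f : F ⟶ c.pt) :
    ∃ (j : J) (g : F ⟶ D.obj j), g ≫ c.ι.app j = f := by
  have := hF J
  have hc' := isColimitOfPreserves (extFunctorObj.{v} F 0) hc
  obtain ⟨j, y, hy⟩ := Concrete.isColimit_exists_rep _ hc' (Ext.mk₀ f)
  obtain ⟨g, rfl⟩ := (Ext.mk₀_bijective F (D.obj j)).2 y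
  refine ⟨j, g, (Ext.mk₀_bijective F c.pt).1 ?_⟩
  rw [← Ext.mk₀_comp_mk₀]
  exact hy

lemma exists_comp_map_eq_zero_of_isColimit {D : J ⥤ G} {c : Cocone D} (hc : IsColimit c) {j : J}
    (f : F ⟶ D.obj j) (hf : f ≫ c.ι.app j = 0) :
    ∃ (k : J) (φ : j ⟶ k), f ≫ D.map φ = 0 := by
  have := hF J
  have hc' := isColimitOfPreserves (extFunctorObj.{v} F 0) hc
  have key : ∀ {Y : G} (h : D.obj j ⟶ Y),
      (extFunctorObj.{v} F 0).map h (Ext.mk₀ f) = Ext.mk₀ (f ≫ h) := fun h =>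
    Ext.mk₀_comp_mk₀ f h
  have h0 : ((extFunctorObj.{v} F 0).mapCocone c).ι.app j (Ext.mk₀ f) =
      ((extFunctorObj.{v} F 0).mapCocone c).ι.app j (Ext.mk₀ (0 : F ⟶ D.obj j)) := by
    refine (key _).trans (Eq.trans ?_ (Ext.mk₀_comp_mk₀ 0 _).symm)
    rw [hf, zero_comp]
  obtain ⟨k, φ, ψ, hk⟩ := Concrete.isColimit_exists_of_rep_eq _ hc' _ _ h0
  refine ⟨k, φ, (Ext.mk₀_bijective F _).1 ?_⟩
  refine (key _).symm.trans (hk.trans ((Ext.mk₀_comp_mk₀ 0 _).trans ?_))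
  rw [zero_comp]

end HomColimits

section HomCokernel

variable {F : G} (hF : PreservesDirectLimits (extFunctorObj.{v} F 0))
  {J : Type v} [PartialOrder J] [IsDirectedOrder J] [Nonempty J]

include hF

lemma exists_comp_cokernelLeg_eq {D : J ⥤ G} {c : Cocone D} (hc : IsColimit c) {Y : G}
    (g : c.pt ⟶ Y) (f : F ⟶ cokernel g) :
    ∃ (j : J) (h : F ⟶ cokernel (coconeLeg c j ≫ g)), h ≫ cokernelLeg c g j = f :=
  exists_factor_of_isColimit hF (isColimitCokernelCocone g hc) f

lemma exists_comp_cokernel_π_eq_zero {D : J ⥤ G} {c : Cocone D} (hc : IsColimit c) {Y : G}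
    (g : c.pt ⟶ Y) (f : F ⟶ Y) (hf : f ≫ cokernel.π g = 0) :
    ∃ j : J, f ≫ cokernel.π (coconeLeg c j ≫ g) = 0 := by
  let j : J := Classical.arbitrary J
  obtain ⟨k, φ, hk⟩ := exists_comp_map_eq_zero_of_isColimit hF (isColimitCokernelCocone g hc)
    (j := j) (f ≫ cokernel.π (coconeLeg c j ≫ g)) (by
      change (f ≫ cokernel.π (coconeLeg c j ≫ g)) ≫ cokernelLeg c g j = 0
      rw [Category.assoc, π_cokernelLeg, hf])
  refine ⟨k, ?_⟩
  rw [← π_cokernelTransition c g φ, ← Category.assoc]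
  exact hk

end HomCokernel

/-! ### Vanishing of `Ext¹` as a lifting problem -/

section ExtOne

lemma exists_lift_of_subsingleton_ext {S : ShortComplex G} (hS : S.ShortExact) {X : G}
    (h : Subsingleton (Ext.{v} X S.X₁ 1)) (f : X ⟶ S.X₃) : ∃ g : X ⟶ S.X₂, g ≫ S.g = f := by
  obtain ⟨x, hx⟩ := Ext.covariant_sequence_exact₃ X hS (Ext.mk₀ f) (zero_add 1)
    (Subsingleton.elim _ _)
  obtain ⟨g, rfl⟩ := (Ext.mk₀_bijective _ _).2 x
  exact ⟨g, (Ext.mk₀_bijective _ _).1 (by rw [← Ext.mk₀_comp_mk₀, hx])⟩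

lemma exists_extension_of_subsingleton_ext {S : ShortComplex G} (hS : S.ShortExact) {M : G}
    (h : Subsingleton (Ext.{v} S.X₃ M 1)) (f : S.X₁ ⟶ M) : ∃ g : S.X₂ ⟶ M, S.f ≫ g = f := by
  obtain ⟨x, hx⟩ := Ext.contravariant_sequence_exact₁ hS M (Ext.mk₀ f) (add_zero 1)
    (Subsingleton.elim _ _)
  obtain ⟨g, rfl⟩ := (Ext.mk₀_bijective _ _).2 x
  exact ⟨g, (Ext.mk₀_bijective _ _).1 (by rw [← Ext.mk₀_comp_mk₀, hx])⟩

/-- `Ext¹(X, S.X₂)` vanishes, so the connecting map from `Hom(X, S.X₃)` is surjective. -/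
lemma exists_eq_comp_extClass {S : ShortComplex G} (hS : S.ShortExact) [Injective S.X₂] {X : G}
    (ξ : Ext.{v} X S.X₁ 1) :
    ∃ f : X ⟶ S.X₃, ξ = (Ext.mk₀ f).comp hS.extClass (zero_add 1) := by
  obtain ⟨x, hx⟩ := Ext.covariant_sequence_exact₁ X hS ξ (Ext.eq_zero_of_injective _) (zero_add 1)
  obtain ⟨f, rfl⟩ := (Ext.mk₀_bijective _ _).2 x
  exact ⟨f, hx.symm⟩

lemma subsingleton_ext_of_exists_lift {S : ShortComplex G} (hS : S.ShortExact) [Injective S.X₂]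
    {X : G} (h : ∀ f : X ⟶ S.X₃, ∃ g : X ⟶ S.X₂, g ≫ S.g = f) :
    Subsingleton (Ext.{v} X S.X₁ 1) := by
  refine subsingleton_of_forall_eq 0 fun ξ => ?_
  obtain ⟨f, rfl⟩ := exists_eq_comp_extClass hS ξ
  obtain ⟨g, rfl⟩ := h f
  rw [← Ext.mk₀_comp_mk₀, Ext.comp_assoc_of_second_deg_zero, hS.comp_extClass, Ext.comp_zero]

lemma subsingleton_ext_iff_exists_lift {M E : G} (i : M ⟶ E) [Mono i] [Injective E] (X : G) :
    Subsingleton (Ext.{v} X M 1) ↔ ∀ f : X ⟶ cokernel i, ∃ g : X ⟶ E, g ≫ cokernel.π i = f :=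
  ⟨fun h f => exists_lift_of_subsingleton_ext (shortExact_cokernelComplex i) h f,
    fun h => subsingleton_ext_of_exists_lift (S := cokernelComplex i)
      (shortExact_cokernelComplex i) h⟩

lemma subsingleton_ext_sigma {I : Type v} (A : I → G) (M : G)
    (h : ∀ i, Subsingleton (Ext.{v} (A i) M 1)) : Subsingleton (Ext.{v} (∐ A) M 1) := by
  rw [subsingleton_ext_iff_exists_lift (Injective.ι M)]
  intro f
  choose g hg using fun i =>
    (subsingleton_ext_iff_exists_lift (Injective.ι M) (A i)).1 (h i) (Sigma.ι A i ≫ f)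
  exact ⟨Sigma.desc g, Sigma.hom_ext _ _ fun i => by simp [hg]⟩

lemma subsingleton_ext_of_retract_left {X Y : G} (i : X ⟶ Y) (r : Y ⟶ X) (hir : i ≫ r = 𝟙 X)
    {M : G} (h : Subsingleton (Ext.{v} Y M 1)) : Subsingleton (Ext.{v} X M 1) := by
  refine subsingleton_of_forall_eq 0 fun ξ => ?_
  rw [← Ext.mk₀_id_comp ξ, ← hir, ← Ext.mk₀_comp_mk₀, Ext.comp_assoc_of_second_deg_zero,
    Subsingleton.elim ((Ext.mk₀ r).comp ξ (zero_add 1)) 0, Ext.comp_zero]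

lemma subsingleton_ext_of_iso_left {X Y : G} (e : X ≅ Y)
    {M : G} (h : Subsingleton (Ext.{v} Y M 1)) : Subsingleton (Ext.{v} X M 1) :=
  subsingleton_ext_of_retract_left e.hom e.inv e.hom_inv_id h

lemma subsingleton_ext_of_shortExact {S : ShortComplex G} (hS : S.ShortExact) {M : G}
    (h₁ : Subsingleton (Ext.{v} S.X₁ M 1)) (h₃ : Subsingleton (Ext.{v} S.X₃ M 1)) :
    Subsingleton (Ext.{v} S.X₂ M 1) := by
  refine subsingleton_of_forall_eq 0 fun ξ => ?_
  obtain ⟨x, rfl⟩ := Ext.contravariant_sequence_exact₂ hS M ξ (Subsingleton.elim _ _)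
  rw [Subsingleton.elim x 0, Ext.comp_zero]

lemma subsingleton_ext_biprod {X Y M : G} (hX : Subsingleton (Ext.{v} X M 1))
    (hY : Subsingleton (Ext.{v} Y M 1)) : Subsingleton (Ext.{v} (X ⊞ Y) M 1) :=
  Ext.biprodAddEquiv.toEquiv.subsingleton

end ExtOne

/-! ### `Ext¹(F, -)` of directed unions and coproducts -/

section DirectLimits

variable {F : G} (hF : PreservesDirectLimits (extFunctorObj.{v} F 0))

include hF in
/-- If `Hom(F, -)` preserves direct limits, then every element of `Ext¹(F, -)` of the union of a
directed system of subobjects comes from one of the subobjects. -/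
lemma exists_ext_comp_coconeLeg_eq {J : Type v} [PartialOrder J] [IsDirectedOrder J] [Nonempty J]
    {D : J ⥤ G} {c : Cocone D} (hc : IsColimit c) (hmono : ∀ j, Mono (coconeLeg c j))
    (ξ : Ext.{v} F c.pt 1) :
    ∃ (j : J) (ζ : Ext.{v} F (D.obj j) 1), ζ.comp (Ext.mk₀ (coconeLeg c j)) (add_zero 1) = ξ := by
  let i := Injective.ι c.pt
  obtain ⟨f, rfl⟩ := exists_eq_comp_extClass (S := cokernelComplex i)
    (shortExact_cokernelComplex i) ξ
  -- The injective object stays fixed while the subobject varies, so the representing map factors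
  -- through a stage and naturality of the extension class concludes.
  obtain ⟨j, g, rfl⟩ := exists_comp_cokernelLeg_eq hF hc i f
  have := hmono j
  have h := shortExact_cokernelComplex (coconeLeg c j ≫ i)
  let φ : cokernelComplex (coconeLeg c j ≫ i) ⟶ cokernelComplex i :=
    { τ₁ := coconeLeg c j
      τ₂ := 𝟙 _
      τ₃ := cokernelLeg c i j
      comm₂₃ := by
        dsimp
        rw [Category.id_comp, π_cokernelLeg] }
  refine ⟨j, (Ext.mk₀ g).comp h.extClass (zero_add 1), ?_⟩
  have h' := ShortComplex.ShortExact.extClass_naturality h (shortExact_cokernelComplex i) φ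
  refine (Ext.comp_assoc_of_third_deg_zero (Ext.mk₀ g) h.extClass
    (Ext.mk₀ (coconeLeg c j)) (zero_add 1)).trans ?_
  refine (congrArg (fun t => (Ext.mk₀ g).comp t (zero_add 1)) h').trans ?_
  rw [← Ext.mk₀_comp_mk₀, Ext.comp_assoc_of_second_deg_zero]

lemma subsingleton_ext_finite_sigma_right {I : Type v} [Finite I] (F : G) (M : I → G)
    (h : ∀ i, Subsingleton (Ext.{v} F (M i) 1)) : Subsingleton (Ext.{v} F (∐ M) 1) := by
  have := Fintype.ofFinite I
  have := Abelian.hasFiniteBiproducts (C := G)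
  have e := biproduct.isoCoproduct M
  have h1 : Subsingleton (Ext.{v} F (⨁ M) 1) :=
    (Ext.addEquivBiproduct F (biproduct.isBilimit M) 1).toEquiv.subsingleton
  refine subsingleton_of_forall_eq 0 fun ζ => ?_
  rw [← Ext.comp_mk₀_id ζ, ← e.inv_hom_id, ← Ext.mk₀_comp_mk₀,
    ← Ext.comp_assoc_of_third_deg_zero,
    Subsingleton.elim (ζ.comp (Ext.mk₀ e.inv) (add_zero 1)) 0, Ext.zero_comp]

include hF in
-- A coproduct is the directed union of its finite subcoproducts, and a class from such a stage is
-- zero by additivity.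
lemma subsingleton_ext_sigma_right {I : Type v} (M : I → G)
    (h : ∀ i, Subsingleton (Ext.{v} F (M i) 1)) : Subsingleton (Ext.{v} F (∐ M) 1) := by
  classical
  let c := CoproductsFromFiniteFiltered.finiteSubcoproductsCocone M
  have hc : IsColimit c := CoproductsFromFiniteFiltered.isColimitFiniteSubproductsCocone M
  -- The inclusion is split by the map killing the summands outside `s`.
  have hmono (s : Finset (Discrete I)) : Mono (coconeLeg c s) := by
    let q : (∐ fun x : s => M x.1.as) ⟶ ∐ M := Sigma.desc fun x => Sigma.ι M x.1.as
    let r : ∐ M ⟶ ∐ fun x : s => M x.1.as := Sigma.desc fun i =>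
      if hi : Discrete.mk i ∈ s then Sigma.ι (fun x : s => M x.1.as) ⟨⟨i⟩, hi⟩ else 0
    have hqr : q ≫ r = 𝟙 _ := by
      refine Sigma.hom_ext _ _ fun x => ?_
      rw [← Category.assoc, Sigma.ι_desc, Sigma.ι_desc, dif_pos x.2, Category.comp_id]
    have : IsSplitMono q := ⟨⟨r, hqr⟩⟩
    exact inferInstanceAs (Mono q)
  refine subsingleton_of_forall_eq 0 fun ξ => ?_
  obtain ⟨s, ζ, rfl⟩ := exists_ext_comp_coconeLeg_eq hF hc hmono ξ
  have hs : Subsingleton (Ext.{v} F (∐ fun x : s => M x.1.as) 1) :=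
    subsingleton_ext_finite_sigma_right F _ fun x => h _
  rw [show ζ = 0 from hs.elim _ _, Ext.zero_comp]
  rfl

end DirectLimits

end GrothendieckTilting

end

noncomputable section

namespace GrothendieckTilting

variable {G : Type u} [Category.{v} G]

lemma mono_ofSequence_map {X : ℕ → G} (f : ∀ n, X n ⟶ X (n + 1)) (hf : ∀ n, Mono (f n))
    {i j : ℕ} (φ : i ⟶ j) : Mono ((Functor.ofSequence f).map φ) := by
  obtain ⟨h⟩ : Nonempty (i ≤ j) := ⟨leOfHom φ⟩
  obtain rfl : φ = homOfLE h := Subsingleton.elim _ _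
  induction j, h using Nat.le_induction with
  | base => rw [Subsingleton.elim (homOfLE _) (𝟙 i), CategoryTheory.Functor.map_id]; infer_instance
  | succ k hk ih =>
    rw [Subsingleton.elim (homOfLE _) (homOfLE hk ≫ homOfLE (Nat.le_add_right k 1)),
      Functor.map_comp, Functor.ofSequence_map_homOfLE_succ]
    have := hf k
    exact @mono_comp _ _ _ _ _ _ ih (f k) (hf k)

variable [Abelian G]

lemma isClosedUnderQuotients_of_isTorsionClass {T : ObjectProperty G} (h : IsTorsionClass T) :
    T.IsClosedUnderQuotients where
  prop_of_epi {X Y} f _ hX := by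
    obtain ⟨F, -, rfl⟩ := h
    intro Z g hZ
    exact (cancel_epi f).1 ((hX (f ≫ g) hZ).trans comp_zero.symm)

variable [IsGrothendieckAbelian.{v} G]

/-! ### Universal extensions -/

section UniversalExtension

/-- Every object `B` embeds in an object `B'` in which all elements of the `Ext¹(C j, B)` vanish,
the cokernel being a coproduct of copies of the objects `C j`. -/
lemma exists_mono_comp_ext_eq_zero {I : Type v} (C : I → G) (B : G) :
    ∃ (B' : G) (i : B ⟶ B'), Mono i ∧
      (∀ (j : I) (ξ : Ext.{v} (C j) B 1), ξ.comp (Ext.mk₀ i) (add_zero 1) = 0) ∧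
      ∀ M : G, (∀ j, Subsingleton (Ext.{v} (C j) M 1)) →
        Subsingleton (Ext.{v} (cokernel i) M 1) := by
  let e := Injective.ι B
  -- One summand per map `C j ⟶ E/B`: these maps represent all classes in the `Ext¹(C j, B)`, so the
  -- extension pulled back along `p` is universal.
  let A : (Σ j, C j ⟶ cokernel e) → G := fun k => C k.1
  let p : ∐ A ⟶ cokernel e := Sigma.desc fun k => k.2
  let i : B ⟶ pullback (cokernel.π e) p := pullback.lift e 0 (by simp)
  have hi : i ≫ pullback.fst (cokernel.π e) p = e := pullback.lift_fst _ _ _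
  have hi' : i ≫ pullback.snd (cokernel.π e) p = 0 := pullback.lift_snd _ _ _
  have hmono : Mono i := by
    have : Mono (i ≫ pullback.fst (cokernel.π e) p) := by rw [hi]; infer_instance
    exact mono_of_mono i (pullback.fst (cokernel.π e) p)
  have he := shortExact_cokernelComplex e
  let S : ShortComplex G := ShortComplex.mk i (pullback.snd (cokernel.π e) p) hi'
  have hS : S.ShortExact :=
    { exact := by
        refine ShortComplex.exact_of_f_is_kernel S (KernelFork.IsLimit.ofι' _ _ fun k hk => ?_)
        have hk' : k ≫ pullback.snd (cokernel.π e) p = 0 := hk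
        have h0 : (k ≫ pullback.fst (cokernel.π e) p) ≫ cokernel.π e = 0 := by
          rw [Category.assoc, pullback.condition, ← Category.assoc, hk', zero_comp]
        have := he.mono_f
        refine ⟨he.exact.lift _ h0, pullback.hom_ext ?_ ?_⟩
        · exact (Category.assoc _ _ _).trans ((congrArg _ hi).trans (he.exact.lift_f _ h0))
        · exact (Category.assoc _ _ _).trans ((congrArg _ hi').trans (comp_zero.trans hk'.symm))
      mono_f := hmono
      epi_g := inferInstanceAs (Epi (pullback.snd (cokernel.π e) p)) }
  refine ⟨_, i, hmono, fun j ξ => ?_, fun M hM => ?_⟩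
  · obtain ⟨f, rfl⟩ := exists_eq_comp_extClass (S := cokernelComplex e) he ξ
    let φ : S ⟶ cokernelComplex e :=
      { τ₁ := 𝟙 B
        τ₂ := pullback.fst _ _
        τ₃ := p
        comm₁₂ := (Category.id_comp _).trans hi.symm
        comm₂₃ := pullback.condition }
    have hφ : hS.extClass = (Ext.mk₀ p).comp he.extClass (zero_add 1) :=
      (Ext.comp_mk₀_id _).symm.trans (ShortComplex.ShortExact.extClass_naturality hS he φ)
    -- Each class is thus a pullback of the class of `S`, which dies when pushed out along its own
    -- `i`.
    have hf : f = Sigma.ι A ⟨j, f⟩ ≫ p :=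
      (Sigma.ι_desc (fun k : Σ j, C j ⟶ cokernel e => k.2) ⟨j, f⟩).symm
    have h0 : hS.extClass.comp (Ext.mk₀ i) (add_zero 1) = 0 := hS.extClass_comp
    rw [hf, ← Ext.mk₀_comp_mk₀, Ext.comp_assoc_of_second_deg_zero, ← hφ,
      Ext.comp_assoc_of_third_deg_zero, h0, Ext.comp_zero]
  · exact subsingleton_ext_of_iso_left
      ((colimit.isColimit _).coconePointUniqueUpToIso hS.gIsCokernel)
      (subsingleton_ext_sigma A M fun k => hM k.1)

/-- Lifting property of a monomorphism with cokernel in `^{⊥₁}M` against the cokernel of an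
embedding of `M` in an injective object. -/
lemma exists_lift_of_subsingleton_ext_cokernel {M E A B : G} (e : M ⟶ E) [Mono e] [Injective E]
    (i : A ⟶ B) [Mono i] (h : Subsingleton (Ext.{v} (cokernel i) M 1)) (a : A ⟶ E)
    (b : B ⟶ cokernel e) (w : a ≫ cokernel.π e = i ≫ b) :
    ∃ l : B ⟶ E, i ≫ l = a ∧ l ≫ cokernel.π e = b := by
  -- Extend `a` to `B` by injectivity; the error term vanishes on `A`, so it descends to `cokernel
  -- i` and lifts to `E`.
  obtain ⟨l, hl⟩ := (subsingleton_ext_iff_exists_lift e _).1 h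
    (cokernel.desc i (b - Injective.factorThru a i ≫ cokernel.π e) (by
      rw [Preadditive.comp_sub, ← Category.assoc, Injective.comp_factorThru, w, sub_self]))
  refine ⟨Injective.factorThru a i + cokernel.π i ≫ l, ?_, ?_⟩
  · rw [Preadditive.comp_add, Injective.comp_factorThru, cokernel.condition_assoc, zero_comp,
      add_zero]
  · rw [Preadditive.add_comp, Category.assoc, hl, cokernel.π_desc, add_sub_cancel]

end UniversalExtension

/-! ### Special preenvelopes by countable iteration -/

section Sequences

/-- The union of an increasing sequence of objects. -/
lemma exists_union_of_sequence {X : ℕ → G} (f : ∀ n, X n ⟶ X (n + 1)) (hf : ∀ n, Mono (f n)) :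
    ∃ (B : G) (ι : ∀ n, X n ⟶ B), (∀ n, f n ≫ ι (n + 1) = ι n) ∧ (∀ n, Mono (ι n)) ∧
      (∀ (Z : G) (g : ∀ n, X n ⟶ Z), (∀ n, f n ≫ g (n + 1) = g n) →
        ∃ h : B ⟶ Z, ∀ n, ι n ≫ h = g n) ∧
      (∀ (Z : G) (g h : B ⟶ Z), (∀ n, ι n ≫ g = ι n ≫ h) → g = h) ∧
      ∀ F : G, PreservesDirectLimits (extFunctorObj.{v} F 0) → ∀ ξ : Ext.{v} F B 1,
        ∃ (n : ℕ) (ζ : Ext.{v} F (X n) 1), ζ.comp (Ext.mk₀ (ι n)) (add_zero 1) = ξ := by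
  have hdown : Monotone (ULift.down : ULift.{v} ℕ → ℕ) := fun _ _ h => h
  let D : ULift.{v} ℕ ⥤ G := hdown.functor ⋙ Functor.ofSequence f
  have hD (i j : ULift.{v} ℕ) (φ : i ⟶ j) : Mono (D.map φ) :=
    mono_ofSequence_map f hf (hdown.functor.map φ)
  let c := colimit.cocone D
  have hc : IsColimit c := colimit.isColimit D
  let ι (n : ℕ) : X n ⟶ c.pt := coconeLeg c ⟨n⟩
  have hι (n : ℕ) : f n ≫ ι (n + 1) = ι n := by
    have h := c.w (j := ⟨n + 1⟩) (j' := ⟨n⟩) (homOfLE (Nat.le_add_right n 1))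
    rw [← Functor.ofSequence_map_homOfLE_succ f n]
    exact h
  have hmono (j : ULift.{v} ℕ) : Mono (coconeLeg c j) := hc.mono_ι_app_of_isFiltered j
  refine ⟨c.pt, ι, hι, fun n => hmono ⟨n⟩, fun Z g hg => ?_, fun Z g h hgh => ?_,
    fun F hF ξ => ?_⟩
  · let γ : Functor.ofSequence f ⟶ (Functor.const ℕ).obj Z := NatTrans.ofSequence g fun n => by
      rw [Functor.ofSequence_map_homOfLE_succ]
      exact (hg n).trans (Category.comp_id _).symm
    let s : Cocone D := { pt := Z, ι := Functor.whiskerLeft hdown.functor γ }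
    exact ⟨hc.desc s, fun n => hc.fac s ⟨n⟩⟩
  · exact hc.hom_ext fun j => hgh j.down
  · obtain ⟨j, ζ, hζ⟩ := exists_ext_comp_coconeLeg_eq hF hc hmono ξ
    exact ⟨j.down, ζ, hζ⟩

/-- Special preenvelopes for the cotorsion pair generated by a set of objects `C j` such that
the functors `Hom(C j, -)` preserve direct limits. -/
lemma exists_special_preenvelope {I : Type v} (C : I → G)
    (hC : ∀ j, PreservesDirectLimits (extFunctorObj.{v} (C j) 0)) (S : G) :
    ∃ (B : G) (i : S ⟶ B), Mono i ∧ (∀ j, Subsingleton (Ext.{v} (C j) B 1)) ∧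
      ∀ M : G, (∀ j, Subsingleton (Ext.{v} (C j) M 1)) →
        Subsingleton (Ext.{v} (cokernel i) M 1) := by
  choose next i hi hkill hperp using exists_mono_comp_ext_eq_zero C
  let X : ℕ → G := fun n => Nat.rec (motive := fun _ => G) S (fun _ B => next B) n
  let f (n : ℕ) : X n ⟶ X (n + 1) := i (X n)
  obtain ⟨B, ι, hι, hmono, hdesc, hext, hstage⟩ := exists_union_of_sequence f fun n => hi (X n)
  let i₀ : S ⟶ B := ι 0
  have h0 : Mono i₀ := hmono 0
  refine ⟨B, i₀, h0, fun j => subsingleton_of_forall_eq 0 fun ξ => ?_, fun M hM => ?_⟩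
  -- A class coming from stage `n` is already killed at stage `n + 1`.
  · obtain ⟨n, ζ, rfl⟩ := hstage (C j) (hC j) ξ
    rw [← hι n, ← Ext.mk₀_comp_mk₀, ← Ext.comp_assoc_of_third_deg_zero, hkill _ j ζ, Ext.zero_comp]
  · let e := Injective.ι M
    rw [subsingleton_ext_iff_exists_lift e]
    intro b
    let b' : B ⟶ cokernel e := cokernel.π i₀ ≫ b
    have hb' : i₀ ≫ b' = 0 := by
      rw [← Category.assoc, cokernel.condition, zero_comp]
    -- Eklof's lemma for a countable filtration: lift `b'` stage by stage, each lift extending the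
    -- previous one.
    have step (n : ℕ) (g : {g : X n ⟶ Injective.under M //
        g ≫ cokernel.π e = ι n ≫ b'}) :
        ∃ g' : X (n + 1) ⟶ Injective.under M, f n ≫ g' = g.1 ∧
          g' ≫ cokernel.π e = ι (n + 1) ≫ b' := by
      have hn : Mono (f n) := hi (X n)
      exact exists_lift_of_subsingleton_ext_cokernel (A := X n) (B := X (n + 1)) e (f n)
        (hperp (X n) M hM) g.1 (ι (n + 1) ≫ b') (by rw [g.2, ← hι n, Category.assoc])
    choose nxt h₁ h₂ using step
    let g (n : ℕ) : {g : X n ⟶ Injective.under M //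
        g ≫ cokernel.π e = ι n ≫ b'} :=
      Nat.rec (motive := fun n => {g : X n ⟶ Injective.under M // g ≫ cokernel.π e = ι n ≫ b'})
        -- Starting from zero on `S` makes the lift descend to `cokernel i₀`.
        ⟨0, by rw [zero_comp]; exact hb'.symm⟩
        (fun n a => ⟨nxt n a, h₂ n a⟩) n
    obtain ⟨l, hl⟩ := hdesc _ (fun n => (g n).1) fun n => h₁ n (g n)
    refine ⟨cokernel.desc i₀ l (hl 0), ?_⟩
    rw [← cancel_epi (cokernel.π i₀)]
    refine hext _ _ _ fun n => ?_
    rw [cokernel.π_desc_assoc, ← Category.assoc, hl n, (g n).2]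

end Sequences

/-! ### Reduction from a class to a set -/

section EssentiallySmall

lemma exists_epi_of_preservesDirectLimits {S F : G} (hS : IsSeparator S)
    (hF : PreservesDirectLimits (extFunctorObj.{v} F 0)) :
    ∃ (n : ℕ) (q : (∐ fun _ : ULift.{v} (Fin n) => S) ⟶ F), Epi q := by
  classical
  let c := CoproductsFromFiniteFiltered.finiteSubcoproductsCocone (fun _ : S ⟶ F => S)
  have hc : IsColimit c := CoproductsFromFiniteFiltered.isColimitFiniteSubproductsCocone _
  let g : (∐ fun _ : S ⟶ F => S) ⟶ F := Sigma.desc fun h => h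
  have hg : Epi g := (isSeparator_iff_epi S).1 hS F
  -- The identity of `F` dies in `cokernel g = 0`, hence already in the cokernel of a finite
  -- subcoproduct.
  obtain ⟨s, hs⟩ := exists_comp_cokernel_π_eq_zero hF hc g (𝟙 F) (by
    rw [Category.id_comp]; exact cokernel.π_of_epi g)
  have hs' : Epi (coconeLeg c s ≫ g) :=
    Preadditive.epi_of_cokernel_zero (by simpa using hs)
  let t : ULift.{v} (Fin s.card) ≃ s := Equiv.ulift.trans s.equivFin.symm
  let q : (∐ fun _ : ULift.{v} (Fin s.card) => S) ⟶ F := Sigma.desc fun k => (t k).1.as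
  refine ⟨s.card, q, ?_⟩
  let r : (∐ fun _ : s => S) ⟶ ∐ fun _ : ULift.{v} (Fin s.card) => S :=
    Sigma.desc fun x => Sigma.ι (fun _ : ULift.{v} (Fin s.card) => S) (t.symm x)
  let l : (∐ fun _ : s => S) ⟶ ∐ fun _ : S ⟶ F => S :=
    Sigma.desc fun x => Sigma.ι (fun _ : S ⟶ F => S) x.1.as
  have hrq : r ≫ q = l ≫ g := by
    refine Sigma.hom_ext _ _ fun x => ?_
    simp [r, q, l, g]
  have : Epi (l ≫ g) := hs'
  have : Epi (r ≫ q) := by rw [hrq]; infer_instance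
  exact epi_of_epi r q

/-- There is only a set of isomorphism classes of objects `F` such that `Hom(F, -)` preserves
direct limits. -/
lemma exists_small_representatives (G : Type u) [Category.{v} G] [Abelian G]
    [IsGrothendieckAbelian.{v} G] :
    ∃ (I : Type v) (K : I → G), ∀ F : G, PreservesDirectLimits (extFunctorObj.{v} F 0) →
      ∃ i, Nonempty (F ≅ K i) := by
  let P (n : ℕ) : G := ∐ fun _ : ULift.{v} (Fin n) => separator G
  refine ⟨Σ n, Shrink.{v} (Subobject (P n)),
    fun k => cokernel ((equivShrink.{v} (Subobject (P k.1))).symm k.2).arrow, fun F hF => ?_⟩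
  obtain ⟨n, q, hq⟩ := exists_epi_of_preservesDirectLimits (isSeparator_separator G) hF
  refine ⟨⟨n, equivShrink _ (Subobject.mk (kernel.ι q))⟩, ⟨?_⟩⟩
  have : Epi (Abelian.factorThruCoimage q) := by
    have : Epi (Abelian.coimage.π q ≫ Abelian.factorThruCoimage q) := by
      rw [Abelian.coimage.fac]; exact hq
    exact epi_of_epi (Abelian.coimage.π q) _
  have : IsIso (Abelian.factorThruCoimage q) := isIso_of_mono_of_epi _
  refine (asIso (Abelian.factorThruCoimage q)).symm ≪≫ ?_
  dsimp only
  rw [Equiv.symm_apply_apply]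
  exact (cokernelEpiComp (Subobject.underlyingIso (kernel.ι q)).hom (kernel.ι q)).symm ≪≫
    cokernelIsoOfEq (Subobject.underlyingIso_hom_comp_eq_mk _)

lemma exists_family_rightExtPerp_iff (C : ObjectProperty G)
    (hC : ∀ F, C F → PreservesDirectLimits (extFunctorObj.{v} F 0)) :
    ∃ (I : Type v) (A : I → G), (∀ i, C (A i)) ∧
      ∀ M, rightExtPerp C M ↔ ∀ i, Subsingleton (Ext.{v} (A i) M 1) := by
  obtain ⟨I, K, hK⟩ := exists_small_representatives G
  choose A hA e using fun i : {i : I // ∃ F, C F ∧ Nonempty (F ≅ K i)} => i.2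
  refine ⟨_, A, hA, fun M => ⟨fun h i => h _ (hA i), fun h X hX => ?_⟩⟩
  obtain ⟨i, ⟨e'⟩⟩ := hK X (hC X hX)
  let k : {i : I // ∃ F, C F ∧ Nonempty (F ≅ K i)} := ⟨i, X, hX, ⟨e'⟩⟩
  exact subsingleton_ext_of_iso_left (e' ≪≫ (e k).some.symm) (h k)

end EssentiallySmall

/-! ### Tilting classes and torsion classes -/

section Tilting

lemma gen_of_forall_factor {S T M : G} (hS : IsSeparator S)
    (h : ∀ f : S ⟶ M, ∃ (a : S ⟶ T) (b : T ⟶ M), a ≫ b = f) : Gen T M := by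
  choose a b hab using h
  have hg : Epi (Sigma.desc fun f : S ⟶ M => f) := (isSeparator_iff_epi S).1 hS M
  let l : (∐ fun _ : S ⟶ M => S) ⟶ ∐ fun _ : S ⟶ M => T :=
    Sigma.desc fun f => a f ≫ Sigma.ι (fun _ : S ⟶ M => T) f
  have hl : l ≫ Sigma.desc b = Sigma.desc fun f : S ⟶ M => f :=
    Sigma.hom_ext _ _ fun f => by simp [l, hab]
  refine ⟨S ⟶ M, Sigma.desc b, ?_⟩
  have : Epi (l ≫ Sigma.desc b) := by rw [hl]; exact hg
  exact epi_of_epi l _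

/-- The image of `q` is the trace of `T` in `X`. It lies in `Gen T = T^⊥`, so every map from `T` to
`X` modulo its trace lifts to `X`, lands in the trace, and is zero. -/
lemma isTorsionClass_gen {T : G} (hT : IsOneTilting T) : IsTorsionClass (Gen T) := by
  refine ⟨(Gen T).rightOrthogonal, rfl, le_antisymm (fun X hX Y f hY => hY f hX) fun X hX => ?_⟩
  let q : (∐ fun _ : T ⟶ X => T) ⟶ X := Sigma.desc fun f => f
  have himg : Gen T (Abelian.image q) := ⟨_, Abelian.factorThruImage q, inferInstance⟩
  rw [hT] at himg
  have hlift (h : T ⟶ cokernel (Abelian.image.ι q)) : h = 0 := by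
    obtain ⟨h', rfl⟩ := exists_lift_of_subsingleton_ext (shortExact_cokernelComplex (Abelian.image.ι q))
      (himg T (by simp)) h
    have hq : h' = Sigma.ι (fun _ : T ⟶ X => T) h' ≫ Abelian.factorThruImage q ≫ Abelian.image.ι q := by
      rw [Abelian.image.fac, Sigma.ι_desc]
    change h' ≫ cokernel.π (Abelian.image.ι q) = 0
    rw [hq, Category.assoc, Category.assoc, cokernel.condition, comp_zero, comp_zero]
  have hπ : cokernel.π (Abelian.image.ι q) = 0 := hX _ fun A a hA => by
    obtain ⟨I, p, hp⟩ := hA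
    refine (cancel_epi p).1 (Sigma.hom_ext _ _ fun i => ?_)
    rw [comp_zero, comp_zero]
    exact hlift _
  have : Epi (Abelian.image.ι q) := Preadditive.epi_of_cokernel_zero hπ
  refine ⟨_, q, ?_⟩
  rw [← Abelian.image.fac q]
  exact epi_comp _ _

/-- `Gen T ⊆ C^⊥` by closure under coproducts and quotients; `C^⊥ ⊆ T^⊥` because `B` is an extension
of `Q` by `S`; and `T^⊥ ⊆ Gen T` because maps from the separator `S` extend to `B`. -/
lemma isOneTiltingClass_rightExtPerp (C : ObjectProperty G)
    (hC : ∀ F, C F → PreservesDirectLimits (extFunctorObj.{v} F 0))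
    (hS : ∃ S : G, leftExtPerp (rightExtPerp C) S ∧ IsSeparator S)
    (hquot : (rightExtPerp C).IsClosedUnderQuotients) : IsOneTiltingClass (rightExtPerp C) := by
  obtain ⟨S, hSC, hS⟩ := hS
  obtain ⟨I, A, hA, hperp⟩ := exists_family_rightExtPerp_iff C hC
  obtain ⟨B, i, hi, hB, hQ⟩ := exists_special_preenvelope A (fun j => hC _ (hA j)) S
  have hBC : rightExtPerp C B := (hperp B).2 hB
  have hQC : rightExtPerp C (cokernel i) :=
    (rightExtPerp C).prop_of_epi (cokernel.π i) hBC
  let T := B ⊞ cokernel i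
  have hTC : rightExtPerp C T := fun X hX => by
    have := hBC X hX
    have := hQC X hX
    exact Ext.addEquivBiprod.toEquiv.subsingleton
  have hgen_le : Gen T ≤ rightExtPerp C := by
    rintro M ⟨J, f, hf⟩
    exact (rightExtPerp C).prop_of_epi f fun X hX =>
      subsingleton_ext_sigma_right (hC X hX) _ fun _ => hTC X hX
  have hle_perp : rightExtPerp C ≤ rightExtPerp (ObjectProperty.singleton T) := by
    rintro M hM X hX
    obtain rfl : T = X := by simpa using hX
    have hQM := hQ M ((hperp M).1 hM)
    exact subsingleton_ext_biprod (subsingleton_ext_of_shortExact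
      (shortExact_cokernelComplex i) (hSC M hM) hQM) hQM
  have hperp_le : rightExtPerp (ObjectProperty.singleton T) ≤ Gen T := by
    intro M hM
    have hQM : Subsingleton (Ext.{v} (cokernel i) M 1) :=
      subsingleton_ext_of_retract_left (biprod.inr : cokernel i ⟶ T) biprod.snd (by simp)
        (hM T (by simp))
    refine gen_of_forall_factor hS fun f => ?_
    obtain ⟨g, hg⟩ := exists_extension_of_subsingleton_ext (shortExact_cokernelComplex i) hQM f
    exact ⟨i ≫ biprod.inl, biprod.fst ≫ g, by simpa using hg⟩
  exact ⟨T, le_antisymm (hgen_le.trans hle_perp) hperp_le,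
    le_antisymm (hle_perp.trans hperp_le) hgen_le⟩

lemma exists_separator_of_containsGeneratingSet {C : ObjectProperty G}
    (h : ContainsGeneratingSet (leftExtPerp C)) : ∃ S : G, leftExtPerp C S ∧ IsSeparator S := by
  obtain ⟨ι, S, hS, hsep⟩ := h
  exact ⟨∐ S, fun M hM => subsingleton_ext_sigma S M fun i => hS i M hM,
    hsep.isSeparator_coproduct⟩

lemma tfae_rightExtPerp (C : ObjectProperty G)
    (hC : ∀ F, C F → PreservesDirectLimits (extFunctorObj.{v} F 0))
    (hS : ∃ S : G, leftExtPerp (rightExtPerp C) S ∧ IsSeparator S) :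
    List.TFAE [IsOneTiltingClass (rightExtPerp C), IsTorsionClass (rightExtPerp C),
      (rightExtPerp C).IsClosedUnderQuotients] := by
  tfae_have 1 → 2 := by
    rintro ⟨T, hT, h⟩
    rw [h]
    exact isTorsionClass_gen hT
  tfae_have 2 → 3 := isClosedUnderQuotients_of_isTorsionClass
  tfae_have 3 → 1 := isOneTiltingClass_rightExtPerp C hC hS
  tfae_finish

end Tilting

end GrothendieckTilting

end

theorem mainTheorem2 {G : Type u} [Category.{v} G] [Abelian G] [IsGrothendieckAbelian.{v} G]
    (n : ℕ) (hn : 1 ≤ n) :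
    (∀ C : ObjectProperty G, C ≤ GrothendieckTilting.IsTypeFP G n →
      (∃ S : G, GrothendieckTilting.leftExtPerp (GrothendieckTilting.rightExtPerp C) S ∧
        IsSeparator S) →
      List.TFAE
        [GrothendieckTilting.IsOneTiltingClass (GrothendieckTilting.rightExtPerp C),
         GrothendieckTilting.IsTorsionClass (GrothendieckTilting.rightExtPerp C),
         (GrothendieckTilting.rightExtPerp C).IsClosedUnderQuotients]) ∧
    (GrothendieckTilting.ContainsGeneratingSet
        (GrothendieckTilting.leftExtPerp (GrothendieckTilting.FPInjective G n)) →
      (GrothendieckTilting.IsTorsionClass (GrothendieckTilting.FPInjective G n) ↔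
        GrothendieckTilting.IsOneTiltingClass (GrothendieckTilting.FPInjective G n))) := by
  -- Only degree `0` of the `FP_n` condition is needed; `1 ≤ n` makes it available.
  refine ⟨fun C hC hS => GrothendieckTilting.tfae_rightExtPerp C (fun F hF => hC F hF 0 hn) hS,
    fun h => ?_⟩
  exact (GrothendieckTilting.tfae_rightExtPerp (GrothendieckTilting.IsTypeFP G n)
    (fun F hF => hF 0 hn)
    (GrothendieckTilting.exists_separator_of_containsGeneratingSet h)).out 1 0
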